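/- Let $C(2^{\mathbb N})$ be the Banach space of continuous scalar-valued (real or complex) functions on the Cantor space $2^{\mathbb N}=\{0,1\}^{\mathbb N}$ with the supremum norm, and let $SB$ be the set of its closed linear subspaces (every separable Banach space is isometric to a member of $SB$). For $X,Y\in SB$ let $\mathcal L(X,Y)$ be the space of bounded linear operators $T:X\to Y$, equipped with the Borel $\sigma$-algebra generated by the strong operator topology (the topology of pointwise norm convergence). A subset $A\subset\mathcal L(X,Y)$ is called analytic if there are a Polish space $P$ and a Borel map $f:P\to\mathcal L(X,Y)$ with $f(P)=A$, and coanalytic if $\mathcal L(X,Y)\setminus A$ is analytic. For all $X,Y\in SB$, the following two subsets of $\mathcal L(X,Y)$ are coanalytic: (a) the set of weakly compact operators, that is, of those $T$ such that $T(B_X)$ is relatively compact in the weak topology of $Y$, where $B_X$ is the closed unit ball of $X$; (b) the set of operators $T$ whose adjoint $T^*:Y^*\to X^*$, $T^*y^*=y^*\circ T$, has norm-separable range (these operators are called Asplund operators). -/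

import Mathlib

namespace OperatorSets

/-- A subset of a measurable space is analytic if it is the image of a Polish space
(with its Borel σ-algebra) under a Borel map. -/
def IsAnalyticSubset {Z : Type*} (m : MeasurableSpace Z) (A : Set Z) : Prop :=
  ∃ (P : Type) (_ : TopologicalSpace P) (_ : PolishSpace P) (f : P → Z),
    @Measurable P Z (borel P) m f ∧ Set.range f = A

/-- A subset is coanalytic if its complement is analytic. -/
def IsCoanalyticSubset {Z : Type*} (m : MeasurableSpace Z) (A : Set Z) : Prop :=
  IsAnalyticSubset m Aᶜ

/-- The set of all closed linear subspaces of `C(2^ℕ)` (scalar-valued, supremum norm);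
every separable Banach space over `𝕜` is isometric to one of them. -/
abbrev SB (𝕜 : Type*) [RCLike 𝕜] : Type _ := ClosedSubmodule 𝕜 C(ℕ → Bool, 𝕜)

section Operators

variable {𝕜 : Type*} [RCLike 𝕜] {X Y : Type*}
  [NormedAddCommGroup X] [NormedSpace 𝕜 X] [NormedAddCommGroup Y] [NormedSpace 𝕜 Y]

variable (𝕜 X Y) in
/-- The strong operator topology (pointwise norm convergence) on the bounded operators. -/
abbrev sotTopology : TopologicalSpace (X →L[𝕜] Y) :=
  TopologicalSpace.induced
    (ContinuousLinearMap.toPointwiseConvergenceCLM 𝕜 (RingHom.id 𝕜) X Y) inferInstance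

variable (𝕜 X Y) in
/-- The Borel σ-algebra of the strong operator topology. -/
abbrev sotBorel : MeasurableSpace (X →L[𝕜] Y) := @borel (X →L[𝕜] Y) (sotTopology 𝕜 X Y)

/-- `T` is weakly compact if the image of the closed unit ball is relatively compact in the
weak topology of `Y`. -/
def IsWeaklyCompactOp (T : X →L[𝕜] Y) : Prop :=
  IsCompact (closure (toWeakSpace 𝕜 Y '' (T '' Metric.closedBall 0 1)))

/-- The Banach space adjoint `T^* : Y^* → X^*`, `y^* ↦ y^* ∘ T`, between the normed duals. -/
noncomputable def adjointOp (T : X →L[𝕜] Y) : StrongDual 𝕜 Y →L[𝕜] StrongDual 𝕜 X :=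
  ContinuousLinearMap.precomp 𝕜 T

/-- `T` is an Asplund operator here if the range of `T^*` is norm-separable. -/
def HasSeparableAdjointRange (T : X →L[𝕜] Y) : Prop :=
  TopologicalSpace.IsSeparable (Set.range (adjointOp T))

end Operators

end OperatorSets

/-!
A set of operators is analytic as soon as membership in it can be witnessed, in a Borel way, by a
point of a Polish space. The space of all operators is not Polish in the strong operator topology,
but its norm balls are (`sotBall.polishSpace`): an operator of norm at most `N` amounts to its
values on a dense sequence, and the possible values form a closed set. Since the balls exhaust the
space, it suffices to find Borel witnesses on each ball (`isAnalyticSubset_of_forall_sotBall`). The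
complements of the two sets in question have such witnesses.

For weak compactness the witness is a sequence in the unit ball, taken from a fixed dense sequence,
whose image `g` has the property that the convex hulls of `{g k | k ≤ n}` and of `{g k | k > n}`
stay at distance at least `ε` for all `n`; this is a closed condition. By Mazur's theorem a
sequence in a relatively weakly compact set never has this property
(`not_hasSeparatedHulls_of_isCompact`). If the image of the ball is not relatively weakly compact,
then its weak-star closure in the bidual contains a point outside the space, and a sequence of
images approximating that point on more and more functionals has the property
(`exists_hasSeparatedHulls_of_not_isCompact`).

For separability of the range of the adjoint `T^*` the witness is a sequence in the unit ball of the
dual of `Y` that has no weak-star isolated term although its image under `T^*` is `ε`-separated in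
norm. Such a sequence contradicts separability of the range by Baire's theorem in its weak-star
closure (`not_hasSeparableAdjointRange`). Conversely, a non-separable range yields an uncountable
subset of the unit ball with `ε`-separated image, and a countable dense subset of its perfect
kernel, in the sense of Cantor and Bendixson, is the desired sequence
(`exists_isSeparatedDenseInItself`).
-/

namespace OperatorSets

open Set Filter Topology MeasureTheory

/-! ### Norm-bounded sets of operators in the strong operator topology -/

section Ball

variable {𝕜 : Type*} [RCLike 𝕜] {X Y : Type*}
  [NormedAddCommGroup X] [NormedSpace 𝕜 X] [NormedAddCommGroup Y] [NormedSpace 𝕜 Y]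

variable (𝕜 X Y) in
/-- The operators of norm at most `N`, inside the bounded operators with the topology of
pointwise convergence. As a type it carries the subspace topology. -/
def sotBall (N : ℝ) : Set (X →Lₚₜ[𝕜] Y) := {T | ∀ x, ‖T x‖ ≤ N * ‖x‖}

/-- Membership of an operator in a strong operator ball, seen through `toPointwiseConvergenceCLM`,
is a bound on its operator norm. -/
theorem toPointwiseConvergenceCLM_mem_sotBall (T : X →L[𝕜] Y) {N : ℝ} (hN : ‖T‖ ≤ N) :
    ContinuousLinearMap.toPointwiseConvergenceCLM 𝕜 (RingHom.id 𝕜) X Y T ∈ sotBall 𝕜 X Y N :=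
  fun x => T.le_of_opNorm_le hN x

theorem sotBall.lipschitzWith {N : ℝ} (T : sotBall 𝕜 X Y N) :
    LipschitzWith N.toNNReal (fun x => T.1 x) := by
  refine LipschitzWith.of_dist_le_mul fun x y => ?_
  rw [dist_eq_norm, dist_eq_norm, ← map_sub]
  exact (T.2 (x - y)).trans
    (mul_le_mul_of_nonneg_right (Real.le_coe_toNNReal N) (norm_nonneg _))

theorem sotBall.continuous_apply (N : ℝ) (x : X) :
    Continuous fun T : sotBall 𝕜 X Y N => T.1 x :=
  (continuous_eval_const (F := X →Lₚₜ[𝕜] Y) x).comp continuous_subtype_val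

/-- On norm-bounded sets, evaluation is jointly continuous for the strong operator topology. -/
theorem sotBall.continuous_eval (N : ℝ) :
    Continuous fun p : sotBall 𝕜 X Y N × X => p.1.1 p.2 :=
  continuous_prod_of_continuous_lipschitzWith'
    (fun p : sotBall 𝕜 X Y N × X => p.1.1 p.2) N.toNNReal
    (fun T => sotBall.lipschitzWith T) (fun x => sotBall.continuous_apply N x)

/-- On a norm-bounded set, the strong operator topology is the topology of pointwise convergence
on a dense sequence, by equicontinuity. -/
theorem sotBall.isInducing_eval_dense (N : ℝ) {d : ℕ → X} (hd : DenseRange d) :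
    IsInducing fun (T : sotBall 𝕜 X Y N) (i : ℕ) => T.1 (d i) := by
  rw [isInducing_iff_nhds]
  intro T
  refine le_antisymm ?_ ?_
  · exact ((continuous_pi fun i => sotBall.continuous_apply N (d i)).tendsto T).le_comap
  · rw [nhds_subtype, ← tendsto_iff_comap]
    refine PointwiseConvergenceCLM.tendsto_iff_forall_tendsto.2 fun x => ?_
    have heq : EquicontinuousAt (fun (S : sotBall 𝕜 X Y N) (x : X) => S.1 x) x :=
      (LipschitzWith.uniformEquicontinuous _ _
        fun S : sotBall 𝕜 X Y N => sotBall.lipschitzWith S).equicontinuous x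
    refine heq.tendsto_of_mem_closure (f := fun x => T.1 x) (s := range d)
      ((sotBall.lipschitzWith T).continuous.continuousAt.mono_left nhdsWithin_le_nhds) ?_ (hd x)
    rintro _ ⟨i, rfl⟩
    have h : Tendsto (fun (S : sotBall 𝕜 X Y N) (i : ℕ) => S.1 (d i))
        (comap _ (𝓝 fun i => T.1 (d i))) (𝓝 fun i => T.1 (d i)) := tendsto_comap
    exact tendsto_pi_nhds.1 h i

/-- A sequence of prescribed values on a dense sequence extends to an operator of norm at most `N`
if and only if the corresponding bound holds on all finite linear combinations. -/
theorem sotBall.range_eval_dense [CompleteSpace Y] (N : ℝ) {d : ℕ → X} (hd : DenseRange d) :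
    range (fun (T : sotBall 𝕜 X Y N) (i : ℕ) => T.1 (d i)) =
      {y | ∀ c : ℕ →₀ 𝕜, ‖Finsupp.linearCombination 𝕜 y c‖ ≤
        N * ‖Finsupp.linearCombination 𝕜 d c‖} := by
  ext y
  constructor
  · rintro ⟨T, rfl⟩ c
    have h : Finsupp.linearCombination 𝕜 (fun i => T.1 (d i)) c =
        T.1 (Finsupp.linearCombination 𝕜 d c) := by
      simp [Finsupp.linearCombination_apply, Finsupp.sum, map_sum]
    rw [h]
    exact T.2 _
  · intro hy
    have hdense : DenseRange (Finsupp.linearCombination 𝕜 d) :=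
      hd.mono (by
        rintro _ ⟨i, rfl⟩
        exact ⟨Finsupp.single i 1, by simp⟩)
    refine ⟨⟨(Finsupp.linearCombination 𝕜 y).extendOfNorm (Finsupp.linearCombination 𝕜 d),
      LinearMap.norm_extendOfNorm_apply_le hdense N hy⟩, ?_⟩
    funext i
    have := LinearMap.extendOfNorm_eq hdense ⟨N, hy⟩ (Finsupp.single i 1)
    simpa using! this

/-- Norm balls of operators between separable Banach spaces are Polish in the strong operator
topology. -/
theorem sotBall.polishSpace [TopologicalSpace.SeparableSpace X] [CompleteSpace Y]
    [SecondCountableTopology Y] (N : ℝ) : PolishSpace (sotBall 𝕜 X Y N) := by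
  have hd := TopologicalSpace.denseRange_denseSeq X
  set d := TopologicalSpace.denseSeq X
  have hind := sotBall.isInducing_eval_dense (𝕜 := 𝕜) (Y := Y) N hd
  have hemb : IsClosedEmbedding fun (T : sotBall 𝕜 X Y N) (i : ℕ) => T.1 (d i) := by
    refine ⟨⟨hind, hind.injective⟩, ?_⟩
    rw [sotBall.range_eval_dense N hd, ofPred_forall]
    refine isClosed_iInter fun c => isClosed_le ?_ continuous_const
    simp only [Finsupp.linearCombination_apply, Finsupp.sum]
    fun_prop
  exact hemb.polishSpace

end Ball

/-! ### Analytic sets of operators -/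

section Analytic

/-- Analytic subsets of a topological space, in the sense of Mathlib, are Borel images of Polish
spaces. -/
theorem isAnalyticSubset_of_analyticSet {Z : Type*} [t : TopologicalSpace Z] {A : Set Z}
    (hA : AnalyticSet A) : IsAnalyticSubset (borel Z) A := by
  rw [AnalyticSet] at hA
  rcases hA with rfl | ⟨f, hf, rfl⟩
  · exact ⟨Empty, ⊥, inferInstance, Empty.elim, fun s _ => by
      rw [Subsingleton.elim (Empty.elim ⁻¹' s) ∅]; exact @MeasurableSet.empty _ (borel Empty),
      range_eq_empty _⟩
  · exact ⟨ℕ → ℕ, inferInstance, inferInstance, f, hf.borel_measurable, rfl⟩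

variable {𝕜 : Type*} [RCLike 𝕜] {X Y : Type*}
  [NormedAddCommGroup X] [NormedSpace 𝕜 X] [NormedAddCommGroup Y] [NormedSpace 𝕜 Y]

/-- A set of operators is analytic as soon as its intersection with every norm ball is the
projection of a Borel subset of the product of that ball with a Polish space. The whole operator
space need not be Polish, but it is the countable union of the balls. -/
theorem isAnalyticSubset_of_forall_sotBall [TopologicalSpace.SeparableSpace X] [CompleteSpace Y]
    [SecondCountableTopology Y] {Q : Type*} [TopologicalSpace Q] [PolishSpace Q]
    {A : Set (X →L[𝕜] Y)} (S : ∀ N : ℕ, Set (sotBall 𝕜 X Y N × Q))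
    (hS : ∀ N, MeasurableSet[borel _] (S N))
    (hA : ∀ (N : ℕ) (T : sotBall 𝕜 X Y N), (T.1 : X →L[𝕜] Y) ∈ A ↔ ∃ q, (T, q) ∈ S N) :
    IsAnalyticSubset (sotBorel 𝕜 X Y) A := by
  let : TopologicalSpace (X →L[𝕜] Y) := sotTopology 𝕜 X Y
  let val (N : ℕ) (p : sotBall 𝕜 X Y N × Q) : X →L[𝕜] Y := p.1.1
  have hval (N : ℕ) : @Continuous _ _ _ (sotTopology 𝕜 X Y) (val N) :=
    continuous_induced_rng.2 (continuous_subtype_val.comp continuous_fst)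
  have hAU : A = ⋃ N : ℕ, val N '' S N := by
    ext T
    simp only [mem_iUnion, mem_image]
    constructor
    · intro hT
      obtain ⟨N, hN⟩ := exists_nat_ge ‖T‖
      obtain ⟨q, hq⟩ := (hA N ⟨_, toPointwiseConvergenceCLM_mem_sotBall T hN⟩).1 hT
      exact ⟨N, _, hq, rfl⟩
    · rintro ⟨N, ⟨T', q⟩, hq, rfl⟩
      exact (hA N T').2 ⟨q, hq⟩
  refine @isAnalyticSubset_of_analyticSet _ (sotTopology 𝕜 X Y) _ ?_
  rw [hAU]
  refine AnalyticSet.iUnion fun N => ?_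
  have := sotBall.polishSpace (𝕜 := 𝕜) (X := X) (Y := Y) N
  let : MeasurableSpace (sotBall 𝕜 X Y N × Q) := borel _
  have : BorelSpace (sotBall 𝕜 X Y N × Q) := ⟨rfl⟩
  exact @AnalyticSet.image_of_continuous _ _ _ (sotTopology 𝕜 X Y) _ (hS N).analyticSet _ (hval N)

end Analytic

/-! ### Weak compactness and separated convex hulls -/

/-- A point outside the range of an isometry from a complete space has positive distance to that
range. -/
theorem exists_pos_forall_le_dist {α β : Type*} [MetricSpace α] [CompleteSpace α]
    [MetricSpace β] {j : α → β} (hj : Isometry j) {x : β} (hx : x ∉ range j) :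
    ∃ δ > 0, ∀ y, δ ≤ dist x (j y) := by
  cases isEmpty_or_nonempty α
  · exact ⟨1, one_pos, isEmptyElim⟩
  rw [← hj.isClosedEmbedding.isClosed_range.closure_eq] at hx
  exact ⟨_, (Metric.infDist_pos_iff_notMem_closure (range_nonempty j)).1 hx,
    fun y => Metric.infDist_le_dist_of_mem (mem_range_self y)⟩

section Bidual

variable {𝕜 : Type*} [RCLike 𝕜] {Y : Type*} [NormedAddCommGroup Y] [NormedSpace 𝕜 Y]

/-- If the closure of a bounded set in the weak topology is not compact, then some element of the
bidual lies in the weak-star closure of the set and at positive distance from the space. -/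
theorem exists_bidual_of_not_isCompact [CompleteSpace Y] {W : Set Y} (hW : Bornology.IsBounded W)
    (hnc : ¬ IsCompact (closure (toWeakSpace 𝕜 Y '' W))) :
    ∃ φ : WeakDual 𝕜 (StrongDual 𝕜 Y), ∃ δ > 0,
      φ ∈ closure (NormedSpace.inclusionInDoubleDualWeak 𝕜 Y '' (toWeakSpace 𝕜 Y '' W)) ∧
      ∀ y : Y, ∃ f : StrongDual 𝕜 Y, ‖f‖ ≤ 1 ∧ δ < ‖φ f - f y‖ := by
  have hbd : Bornology.IsBounded (toWeakSpace 𝕜 Y ⁻¹' (toWeakSpace 𝕜 Y '' W)) := by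
    rwa [preimage_image_eq _ (toWeakSpace 𝕜 Y).injective]
  have hnr := mt (NormedSpace.isCompact_closure_of_isBounded 𝕜 Y _ hbd) hnc
  obtain ⟨φ, hφ, hφr⟩ := not_subset.1 hnr
  have hJy (y : Y) (f : StrongDual 𝕜 Y) : NormedSpace.inclusionInDoubleDualLi 𝕜 y f = f y := rfl
  have hφJ : WeakDual.toStrongDual φ ∉ range (NormedSpace.inclusionInDoubleDualLi (E := Y) 𝕜) := by
    rintro ⟨y, hy⟩
    refine hφr ⟨toWeakSpace 𝕜 Y y, DFunLike.ext _ _ fun f => ?_⟩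
    exact (hJy y f).symm.trans (DFunLike.congr_fun hy f)
  obtain ⟨δ, hδ, hJ⟩ := exists_pos_forall_le_dist
    (NormedSpace.inclusionInDoubleDualLi (E := Y) 𝕜).isometry hφJ
  refine ⟨φ, δ / 2, half_pos hδ, hφ, fun y => ?_⟩
  by_contra! hcon
  have h1 : ‖WeakDual.toStrongDual φ - NormedSpace.inclusionInDoubleDualLi 𝕜 y‖ ≤ δ / 2 := by
    refine ContinuousLinearMap.opNorm_le_of_unit_norm (half_pos hδ).le fun f hf => ?_
    rw [sub_apply, hJy, WeakDual.toStrongDual_apply]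
    exact hcon f hf.le
  have h2 := hJ y
  rw [dist_eq_norm] at h2
  linarith

end Bidual

section SeparatedHulls

variable {Y : Type*} [NormedAddCommGroup Y] [NormedSpace ℝ Y]

/-- The convex hulls of the initial segments and of the tails of the sequence `g` stay at distance
at least `ε` from each other. -/
def HasSeparatedHulls (g : ℕ → Y) (ε : ℝ) : Prop :=
  ∀ n, ∀ u ∈ convexHull ℝ (g '' Iic n), ∀ v ∈ convexHull ℝ (g '' Ioi n), ε ≤ ‖u - v‖

/-- Convex combinations of a sequence are parametrized by finitely supported weights, in a way
that does not depend on the sequence. -/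
theorem hasSeparatedHulls_iff (g : ℕ → Y) (ε : ℝ) :
    HasSeparatedHulls g ε ↔
      ∀ n, ∀ a ∈ convexHull ℝ ((fun k => Finsupp.single k (1 : ℝ)) '' Iic n),
        ∀ b ∈ convexHull ℝ ((fun k => Finsupp.single k (1 : ℝ)) '' Ioi n),
          ε ≤ ‖Finsupp.linearCombination ℝ g (a - b)‖ := by
  have key (I : Set ℕ) : convexHull ℝ (g '' I) = Finsupp.linearCombination ℝ g ''
      convexHull ℝ ((fun k => Finsupp.single k (1 : ℝ)) '' I) := by
    rw [LinearMap.image_convexHull, image_image]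
    simp
  simp only [HasSeparatedHulls, key, forall_mem_image, map_sub]

theorem isClosed_setOf_hasSeparatedHulls {Z : Type*} [TopologicalSpace Z] {G : Z → ℕ → Y}
    {ε : Z → ℝ} (hG : ∀ k, Continuous fun z => G z k) (hε : Continuous ε) :
    IsClosed {z | HasSeparatedHulls (G z) (ε z)} := by
  simp only [hasSeparatedHulls_iff, ofPred_forall]
  refine isClosed_iInter fun n => isClosed_iInter fun a => isClosed_iInter fun _ =>
    isClosed_iInter fun b => isClosed_iInter fun _ => isClosed_le hε ?_
  simp only [Finsupp.linearCombination_apply, Finsupp.sum]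
  fun_prop

variable {𝕜 : Type*} [RCLike 𝕜] {X : Type*} [NormedAddCommGroup X] [NormedSpace 𝕜 X]
  [NormedSpace 𝕜 Y] [IsScalarTower ℝ 𝕜 Y]

variable (𝕜) in
/-- A weak cluster point of `g` lies, by Mazur's theorem, in the norm closure of the convex hull of
every tail, and hence is nearly attained by an initial segment. -/
theorem not_hasSeparatedHulls_of_isCompact {g : ℕ → Y} {K : Set (WeakSpace 𝕜 Y)}
    (hK : IsCompact K) (hg : ∀ n, toWeakSpace 𝕜 Y (g n) ∈ K) {ε : ℝ} (hε : 0 < ε) :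
    ¬ HasSeparatedHulls g ε := by
  intro hsep
  obtain ⟨z, -, hz⟩ := hK.exists_mapClusterPt (f := atTop)
    (u := fun n => toWeakSpace 𝕜 Y (g n)) 
    (le_principal_iff.2 (mem_map.2 (Eventually.of_forall hg)))
  obtain ⟨y, rfl⟩ := (toWeakSpace 𝕜 Y).surjective z
  have hmem (I : Set ℕ) (hI : I ∈ atTop) : y ∈ closure (convexHull ℝ (g '' I)) := by
    have h1 : toWeakSpace 𝕜 Y y ∈ closure (toWeakSpace 𝕜 Y '' convexHull ℝ (g '' I)) := by
      refine closure_mono ?_ (ClusterPt.mem_closure_of_mem hz _ (image_mem_map hI))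
      rintro _ ⟨n, hn, rfl⟩
      exact mem_image_of_mem _ (subset_convexHull ℝ _ (mem_image_of_mem g hn))
    rw [← (convex_convexHull ℝ _).toWeakSpace_closure 𝕜] at h1
    exact (toWeakSpace 𝕜 Y).injective.mem_set_image.1 h1
  obtain ⟨u, hu, hyu⟩ := Metric.mem_closure_iff.1 (hmem univ univ_mem) (ε / 2) (half_pos hε)
  have hunion : convexHull ℝ (g '' univ) ⊆ ⋃ n, convexHull ℝ (g '' Iic n) := by
    have hmono : Monotone fun n => convexHull ℝ (g '' Iic n) := fun m n hmn =>
      convexHull_mono (image_mono (Iic_subset_Iic.2 hmn))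
    refine convexHull_min ?_ (hmono.directed_le.convex_iUnion fun n => convex_convexHull ℝ _)
    rintro _ ⟨n, -, rfl⟩
    exact mem_iUnion.2 ⟨n, subset_convexHull ℝ _ (mem_image_of_mem g (mem_Iic.2 le_rfl))⟩
  obtain ⟨n, hn⟩ := mem_iUnion.1 (hunion hu)
  obtain ⟨v, hv, hyv⟩ := Metric.mem_closure_iff.1 (hmem (Ioi n) (Ioi_mem_atTop n)) (ε / 2)
    (half_pos hε)
  have h1 := hsep n u hn v hv
  have h2 := dist_triangle_left u v y
  rw [dist_eq_norm u v] at h2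
  linarith

/-- The converse of `not_hasSeparatedHulls_of_isCompact`. Given `φ` in the weak-star closure of the
bounded sequence, finitely many functionals of norm at most `1` witness that `φ` is far from the
compact convex hull of finitely many terms; the next terms are chosen close to `φ` on all
functionals used so far, and so are then their convex combinations. -/
theorem exists_hasSeparatedHulls_of_not_isCompact [CompleteSpace Y] {g : ℕ → Y}
    (hg : Bornology.IsBounded (range g))
    (hnc : ¬ IsCompact (closure (toWeakSpace 𝕜 Y '' range g))) :
    ∃ s : ℕ → ℕ, ∃ ε > 0, HasSeparatedHulls (fun k => g (s k)) ε := by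
  classical
  obtain ⟨φ, δ, hδ, hφ, hfar⟩ := exists_bidual_of_not_isCompact hg hnc
  have hF (H : Finset ℕ) : ∃ F : Finset (StrongDual 𝕜 Y),
      ∀ u ∈ convexHull ℝ (g '' H), ∃ f ∈ F, ‖f‖ ≤ 1 ∧ δ < ‖φ f - f u‖ := by
    have hc : IsCompact (convexHull ℝ (g '' H)) :=
      Set.Finite.isCompact_convexHull ℝ (H.finite_toSet.image g)
    obtain ⟨F, hF⟩ := hc.elim_finite_subcover
      (fun f : {f : StrongDual 𝕜 Y // ‖f‖ ≤ 1} => {u | δ < ‖φ f.1 - f.1 u‖})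
      (fun f => isOpen_lt continuous_const (by fun_prop))
      (fun u _ => by
        obtain ⟨f, hf, h⟩ := hfar u
        exact mem_iUnion.2 ⟨⟨f, hf⟩, h⟩)
    refine ⟨F.image Subtype.val, fun u hu => ?_⟩
    obtain ⟨f, hfF, h⟩ := mem_iUnion₂.1 (hF hu)
    exact ⟨f.1, Finset.mem_image_of_mem _ hfF, f.2, h⟩
  choose F hF using hF
  -- The first component of a pair records the indices chosen so far, the second one the last index.
  obtain ⟨p, hp, hpr⟩ := exists_seq_of_forall_finset_exists
    (fun p : Finset ℕ × ℕ => p.2 ∈ p.1)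
    (fun p q => p.1 ⊆ q.1 ∧ ∀ f ∈ F p.1, ‖φ f - f (g q.2)‖ < δ / 2)
    (fun s _ => by
      let G := s.biUnion fun p => F p.1
      have hopen : IsOpen {ψ : WeakDual 𝕜 (StrongDual 𝕜 Y) | ∀ f ∈ G, ‖φ f - ψ f‖ < δ / 2} := by
        simp only [ofPred_forall]
        exact isOpen_biInter_finset fun f _ =>
          isOpen_lt (continuous_const.sub (WeakDual.eval_continuous f)).norm continuous_const
      obtain ⟨_, hψ, _, ⟨_, ⟨i, rfl⟩, rfl⟩, rfl⟩ :=
        mem_closure_iff.1 hφ _ hopen (fun f _ => by simpa using half_pos hδ)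
      refine ⟨(insert i (s.biUnion Prod.fst), i), Finset.mem_insert_self _ _, fun p hp => ⟨?_, ?_⟩⟩
      · exact (Finset.subset_biUnion_of_mem Prod.fst hp).trans (Finset.subset_insert _ _)
      · exact fun f hf => hψ f (Finset.mem_biUnion.2 ⟨p, hp, hf⟩))
  refine ⟨fun k => (p k).2, δ / 2, half_pos hδ, fun n u hu v hv => ?_⟩
  have hu' : u ∈ convexHull ℝ (g '' (p n).1) := by
    refine convexHull_mono ?_ hu
    rintro _ ⟨k, hk, rfl⟩
    refine mem_image_of_mem g ?_
    rcases (mem_Iic.1 hk).eq_or_lt with rfl | hlt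
    · exact hp k
    · exact (hpr k n hlt).1 (hp k)
  obtain ⟨f, hfF, hf1, hfu⟩ := hF _ u hu'
  have hv' : ‖φ f - f v‖ ≤ δ / 2 := by
    have hconv : Convex ℝ ((f.restrictScalars ℝ).toLinearMap ⁻¹' Metric.closedBall (φ f) (δ / 2)) :=
      (convex_closedBall _ _).linear_preimage _
    have hsub := convexHull_min (s := (fun k => g (p k).2) '' Ioi n) (by
      rintro _ ⟨k, hk, rfl⟩
      have := ((hpr n k hk).2 f hfF).le
      rwa [← dist_eq_norm, dist_comm] at this) hconv
    have := hsub hv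
    rwa [mem_preimage, Metric.mem_closedBall, dist_comm, dist_eq_norm] at this
  have h1 : ‖f u - f v‖ ≤ ‖u - v‖ := by
    rw [← map_sub]
    simpa using f.le_of_opNorm_le hf1 (u - v)
  have h2 : ‖φ f - f u‖ ≤ ‖φ f - f v‖ + ‖f u - f v‖ := by
    rw [norm_sub_rev (f u)]
    exact norm_sub_le_norm_sub_add_norm_sub _ _ _
  linarith

/-- An operator fails to be weakly compact if and only if some sequence of values at points of a
given dense sequence in the unit ball has separated hulls. -/
theorem not_isWeaklyCompactOp_iff [CompleteSpace Y] {d : ℕ → Metric.closedBall (0 : X) 1}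
    (hd : DenseRange d) (T : X →L[𝕜] Y) :
    ¬ IsWeaklyCompactOp T ↔
      ∃ q : ℕ × (ℕ → ℕ), HasSeparatedHulls (fun k => T (d (q.2 k))) (1 / ((q.1 : ℝ) + 1)) := by
  constructor
  · intro hT
    have hsub : toWeakSpace 𝕜 Y '' (T '' Metric.closedBall 0 1) ⊆
        closure (toWeakSpace 𝕜 Y '' range fun i => T (d i)) := by
      rintro _ ⟨_, ⟨x, hx, rfl⟩, rfl⟩
      have hcont : Continuous fun z : Metric.closedBall (0 : X) 1 => toWeakSpace 𝕜 Y (T z) :=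
        (toWeakSpaceCLM 𝕜 Y).continuous.comp (T.continuous.comp continuous_subtype_val)
      have := image_closure_subset_closure_image hcont
        (mem_image_of_mem _ (hd ⟨x, hx⟩))
      rwa [← range_comp] at this ⊢
    have hnc : ¬ IsCompact (closure (toWeakSpace 𝕜 Y '' range fun i => T (d i))) := fun h =>
      hT (h.of_isClosed_subset isClosed_closure (closure_minimal hsub isClosed_closure))
    have hbdd : Bornology.IsBounded (range fun i => T (d i)) := by
      refine (T.lipschitz.isBounded_image
        (Metric.isBounded_closedBall (x := (0 : X)) (r := 1))).subset ?_
      rintro _ ⟨i, rfl⟩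
      exact mem_image_of_mem T (d i).2
    obtain ⟨s, ε, hε, hs⟩ := exists_hasSeparatedHulls_of_not_isCompact hbdd hnc
    obtain ⟨m, hm⟩ := exists_nat_one_div_lt hε
    exact ⟨(m, s), fun n u hu v hv => hm.le.trans (hs n u hu v hv)⟩
  · rintro ⟨q, hq⟩ hT
    refine not_hasSeparatedHulls_of_isCompact 𝕜 hT (fun n => subset_closure ?_)
      (by positivity) hq
    exact mem_image_of_mem _ (mem_image_of_mem T (d _).2)

end SeparatedHulls

section WeaklyCompact

variable {𝕜 : Type*} [RCLike 𝕜] {X Y : Type*}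
  [NormedAddCommGroup X] [NormedSpace 𝕜 X] [NormedAddCommGroup Y] [NormedSpace 𝕜 Y]

theorem isCoanalyticSubset_isWeaklyCompactOp [TopologicalSpace.SeparableSpace X] [CompleteSpace Y]
    [SecondCountableTopology Y] :
    IsCoanalyticSubset (sotBorel 𝕜 X Y) {T : X →L[𝕜] Y | IsWeaklyCompactOp T} := by
  let : NormedSpace ℝ Y := NormedSpace.restrictScalars ℝ 𝕜 Y
  have : IsScalarTower ℝ 𝕜 Y := inferInstance
  have : Nonempty (Metric.closedBall (0 : X) 1) := ⟨⟨0, by simp⟩⟩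
  obtain ⟨d, hd⟩ := TopologicalSpace.exists_dense_seq (Metric.closedBall (0 : X) 1)
  refine isAnalyticSubset_of_forall_sotBall (Q := ℕ × (ℕ → ℕ))
    (fun N => {p | HasSeparatedHulls (fun k => p.1.1 (d (p.2.2 k))) (1 / ((p.2.1 : ℝ) + 1))})
    (fun N => ?_) (fun N T => not_isWeaklyCompactOp_iff hd T.1)
  let : MeasurableSpace (sotBall 𝕜 X Y N × (ℕ × (ℕ → ℕ))) := borel _
  have : BorelSpace (sotBall 𝕜 X Y N × (ℕ × (ℕ → ℕ))) := ⟨rfl⟩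
  refine (isClosed_setOf_hasSeparatedHulls (fun k => ?_) ?_).measurableSet
  · have hdk : Continuous fun q : ℕ × (ℕ → ℕ) => (d (q.2 k) : X) :=
      (continuous_of_discreteTopology (f := fun i => (d i : X))).comp
        ((continuous_apply k).comp continuous_snd)
    exact (sotBall.continuous_eval N).comp
      (continuous_fst.prodMk (hdk.comp continuous_snd))
  · exact (continuous_of_discreteTopology (f := fun m : ℕ => 1 / ((m : ℝ) + 1))).comp
      (continuous_fst.comp continuous_snd)

end WeaklyCompact

/-! ### Separated sequences without isolated points -/

section Topological

/-- An uncountable second-countable space contains an injective sequence none of whose terms is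
isolated among the others: a countable dense subset of the perfect kernel. -/
theorem exists_seq_forall_not_isolated (Z : Type*) [TopologicalSpace Z]
    [SecondCountableTopology Z] [T1Space Z] (hZ : ¬ (univ : Set Z).Countable) :
    ∃ f : ℕ → Z, Function.Injective f ∧
      ∀ n, ∀ U, IsOpen U → f n ∈ U → ∃ m ≠ n, f m ∈ U := by
  obtain ⟨D, hD, ⟨w, hw⟩, -⟩ :=
    exists_perfect_nonempty_of_isClosed_of_not_countable isClosed_univ hZ
  obtain ⟨s, hsc, hsd⟩ := TopologicalSpace.exists_countable_dense D
  have key : ∀ U : Set Z, IsOpen U → ∀ x ∈ D, x ∈ U → ∃ y ∈ s, (y : Z) ∈ U ∧ (y : Z) ≠ x := by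
    intro U hU x hxD hxU
    obtain ⟨y, ⟨hyU, hyD⟩, hyx⟩ :=
      preperfect_iff_nhds.1 hD.acc x hxD U (hU.mem_nhds hxU)
    have hopen : IsOpen ((↑) ⁻¹' (U \ {x}) : Set D) :=
      (hU.sdiff isClosed_singleton).preimage continuous_subtype_val
    obtain ⟨z, hz, hzs⟩ := hsd.inter_open_nonempty _ hopen ⟨⟨y, hyD⟩, hyU, hyx⟩
    exact ⟨z, hzs, hz.1, hz.2⟩
  have hinf : s.Infinite := by
    intro hfin
    obtain ⟨x, hxs, -, -⟩ := key univ isOpen_univ w hw (mem_univ w)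
    have hfin' : ((↑) '' (s \ {x}) : Set Z).Finite := (hfin.subset sdiff_subset).image _
    obtain ⟨y, hys, hyU, hyx⟩ := key _ hfin'.isClosed.isOpen_compl x x.2 (by
      rintro ⟨y, ⟨-, hy⟩, hyx⟩
      exact hy (Subtype.ext hyx))
    exact hyU ⟨y, ⟨hys, fun h => hyx (congrArg _ h)⟩, rfl⟩
  have : Countable s := hsc
  have : Infinite s := hinf.to_subtype
  obtain ⟨e⟩ := nonempty_equiv_of_countable (α := ℕ) (β := s)
  refine ⟨fun n => (e n).1.1, fun m n h => e.injective (Subtype.ext (Subtype.ext h)), ?_⟩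
  intro n U hU hn
  obtain ⟨y, hys, hyU, hyx⟩ := key U hU _ (e n).1.2 hn
  refine ⟨e.symm ⟨y, hys⟩, ?_, by simpa using hyU⟩
  rintro rfl
  simp at hyx

/-- A non-separable set contains an uncountable subset that is separated by some `ε`. -/
theorem exists_not_countable_isSeparated {Z : Type*} [PseudoEMetricSpace Z] {s : Set Z}
    (hs : ¬ TopologicalSpace.IsSeparable s) :
    ∃ ε > 0, ∃ t ⊆ s, ¬ t.Countable ∧ Metric.IsSeparated ε t := by
  by_contra! hcon
  refine hs ?_
  obtain ⟨t, -, htc, hst⟩ := EMetric.subset_countable_closure_of_almost_dense_set s (by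
    intro ε hε
    obtain ⟨t, ht⟩ := zorn_subset {t : Set Z | t ⊆ s ∧ Metric.IsSeparated ε t} (by
      intro c hc hchain
      refine ⟨⋃₀ c, ⟨sUnion_subset fun t ht => (hc ht).1, ?_⟩, fun t ht => subset_sUnion_of_mem ht⟩
      exact (pairwise_sUnion hchain.directedOn).2 fun t ht => (hc ht).2)
    refine ⟨t, by_contra fun htc => hcon ε hε t ht.prop.1 htc ht.prop.2, fun x hx => ?_⟩
    by_contra hxt
    have hxt' : ∀ y ∈ t, ε < edist x y := by simpa using hxt
    have hins : insert x t ∈ {t : Set Z | t ⊆ s ∧ Metric.IsSeparated ε t} :=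
      ⟨insert_subset hx ht.prop.1, ht.prop.2.insert fun y hy _ => hxt' y hy⟩
    have hxmem : x ∈ t := ht.le_of_ge hins (subset_insert x t) (mem_insert x t)
    simpa using hxt' x hxmem)
  exact ⟨t, htc, hst⟩

end Topological

/-! ### Separability of the range of the adjoint -/

section Asplund

variable {𝕜 : Type*} [RCLike 𝕜] {X Y : Type*}
  [NormedAddCommGroup X] [NormedSpace 𝕜 X] [NormedAddCommGroup Y] [NormedSpace 𝕜 Y]

/-- The sequence `f` in the unit ball of the dual of `Y` is pulled back by `T` to a norm
`ε`-separated sequence, while no term is weak-star isolated among the others. The second condition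
is tested on a family `b` of sets, in practice a countable basis of the weak-star topology of the
ball, so that it is visibly Borel in `f`. -/
def IsSeparatedDenseInItself (T : X → Y) (f : ℕ → sotBall 𝕜 Y 𝕜 1) (ε : ℝ)
    (b : Set (Set (sotBall 𝕜 Y 𝕜 1))) : Prop :=
  (∀ n m, n ≠ m → ∃ x, ε * ‖x‖ < ‖(f n).1 (T x) - (f m).1 (T x)‖) ∧
    ∀ n, ∀ U ∈ b, f n ∈ U → ∃ m ≠ n, f m ∈ U

/-- If the range of the adjoint were separable, then by Baire's theorem some nonempty relatively
open subset of the weak-star closure of the sequence would have small image under the adjoint;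
but it contains two terms of the sequence. -/
theorem not_hasSeparableAdjointRange [TopologicalSpace.SeparableSpace Y] (T : X →L[𝕜] Y)
    {f : ℕ → sotBall 𝕜 Y 𝕜 1} {ε : ℝ} (hε : 0 < ε) {b : Set (Set (sotBall 𝕜 Y 𝕜 1))}
    (hb : TopologicalSpace.IsTopologicalBasis b) (hf : IsSeparatedDenseInItself T f ε b) :
    ¬ HasSeparableAdjointRange T := by
  rintro ⟨c, hc, hTc⟩
  have := sotBall.polishSpace (𝕜 := 𝕜) (X := Y) (Y := 𝕜) 1
  let C := closure (range f)
  have : PolishSpace C := isClosed_closure.polishSpace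
  have : Nonempty C := ⟨⟨f 0, subset_closure (mem_range_self 0)⟩⟩
  have : Countable c := hc
  let F (g : c) : Set C := {h | ∀ x, ‖h.1.1 (T x) - g.1 x‖ ≤ ε / 2 * ‖x‖}
  have hFc (g : c) : IsClosed (F g) := by
    simp only [F, ofPred_forall]
    refine isClosed_iInter fun x => isClosed_le ?_ continuous_const
    exact (((sotBall.continuous_apply 1 (T x)).comp continuous_subtype_val).sub
      continuous_const).norm
  have hFU : ⋃ g, F g = univ := by
    refine eq_univ_of_forall fun h => ?_
    obtain ⟨g, hg, hd⟩ := Metric.mem_closure_iff.1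
      (hTc (mem_range_self (h.1.1 : StrongDual 𝕜 Y))) (ε / 2) (half_pos hε)
    refine mem_iUnion.2 ⟨⟨g, hg⟩, fun x => ?_⟩
    rw [dist_eq_norm] at hd
    exact ContinuousLinearMap.le_of_opNorm_le _ hd.le x
  obtain ⟨g, w, hw⟩ := nonempty_interior_of_iUnion_of_closed hFc hFU
  obtain ⟨V, hV, hVF⟩ := isOpen_induced_iff.1 (isOpen_interior (s := F g))
  have hVmem (n : ℕ) (hn : f n ∈ V) : ∀ x, ‖(f n).1 (T x) - g.1 x‖ ≤ ε / 2 * ‖x‖ := by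
    have : (⟨f n, subset_closure (mem_range_self n)⟩ : C) ∈ interior (F g) := by
      rw [← hVF]; exact hn
    exact interior_subset this
  have hwV : w.1 ∈ V := by rw [← hVF] at hw; exact hw
  obtain ⟨_, hnV, n, rfl⟩ := mem_closure_iff.1 w.2 V hV hwV
  obtain ⟨U, hUb, hnU, hUV⟩ := hb.exists_subset_of_mem_open hnV hV
  obtain ⟨m, hmn, hmU⟩ := hf.2 n U hUb hnU
  obtain ⟨x, hx⟩ := hf.1 n m hmn.symm
  have h1 := hVmem n hnV x
  have h2 := hVmem m (hUV hmU) x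
  have h3 := norm_sub_le_norm_sub_add_norm_sub ((f n).1 (T x)) (g.1 x) ((f m).1 (T x))
  rw [norm_sub_rev (g.1 x)] at h3
  linarith

/-- The converse of `not_hasSeparableAdjointRange`: the unit ball of the dual of `Y` contains an
uncountable set with separated image, and the weak-star topology of the ball is second countable. -/
theorem exists_isSeparatedDenseInItself [TopologicalSpace.SeparableSpace Y] (T : X →L[𝕜] Y)
    (hT : ¬ HasSeparableAdjointRange T) {b : Set (Set (sotBall 𝕜 Y 𝕜 1))}
    (hb : TopologicalSpace.IsTopologicalBasis b) :
    ∃ f, ∃ m : ℕ, IsSeparatedDenseInItself T f (1 / ((m : ℝ) + 1)) b := by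
  have := sotBall.polishSpace (𝕜 := 𝕜) (X := Y) (Y := 𝕜) 1
  let Φ (h : sotBall 𝕜 Y 𝕜 1) : StrongDual 𝕜 X := adjointOp T h.1
  have hΦ : ¬ TopologicalSpace.IsSeparable (range Φ) := by
    intro hsep
    refine hT ((hsep.span (R := 𝕜)).mono ?_)
    rintro _ ⟨h, rfl⟩
    -- The functional is a multiple of one in the unit ball.
    obtain ⟨r, hr⟩ := exists_nat_gt ‖h‖
    have hr0 : (0 : ℝ) < r := (norm_nonneg h).trans_lt hr
    have hr1 : (r : 𝕜) ≠ 0 := by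
      intro h0
      simp only [Nat.cast_eq_zero] at h0
      simp [h0] at hr0
    have hmem : ‖(r : 𝕜)⁻¹ • h‖ ≤ 1 := by
      rw [norm_smul, norm_inv, RCLike.norm_natCast, inv_mul_le_iff₀ hr0, mul_one]
      exact hr.le
    have hsm : adjointOp T h = (r : 𝕜) • adjointOp T ((r : 𝕜)⁻¹ • h) := by
      rw [map_smul, smul_inv_smul₀ hr1]
    rw [hsm]
    exact Submodule.smul_mem _ _ (Submodule.subset_span
      ⟨⟨_, toPointwiseConvergenceCLM_mem_sotBall _ hmem⟩, rfl⟩)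
  obtain ⟨ε, hε, t, htΦ, htc, hts⟩ := exists_not_countable_isSeparated hΦ
  obtain ⟨E, -, hE⟩ := exists_subset_bijOn (Φ ⁻¹' t) Φ
  rw [image_preimage_eq_of_subset htΦ] at hE
  have hEc : ¬ (univ : Set E).Countable := by
    intro h
    refine htc ?_
    rw [← hE.image_eq]
    exact Countable.image (countable_univ_iff.1 h) Φ
  obtain ⟨f, hinj, hf⟩ := exists_seq_forall_not_isolated E hEc
  obtain ⟨m, hm⟩ : ∃ m : ℕ, ENNReal.ofReal (1 / ((m : ℝ) + 1)) < ε := by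
    have h := ENNReal.tendsto_ofReal (tendsto_one_div_add_atTop_nhds_zero_nat (𝕜 := ℝ))
    rw [ENNReal.ofReal_zero] at h
    exact (h.eventually_lt_const hε).exists
  refine ⟨fun n => (f n).1, m, fun n k hnk => ?_, fun n U hU hn => ?_⟩
  · by_contra! hcon
    have hne : Φ (f n).1 ≠ Φ (f k).1 := fun h =>
      hnk (hinj (Subtype.ext (hE.injOn (f n).2 (f k).2 h)))
    have h1 : ε < edist (Φ (f n).1) (Φ (f k).1) := hts (hE.mapsTo (f n).2) (hE.mapsTo (f k).2) hne
    have h2 : ‖Φ (f n).1 - Φ (f k).1‖ ≤ 1 / ((m : ℝ) + 1) :=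
      ContinuousLinearMap.opNorm_le_bound _ (by positivity) hcon
    rw [edist_dist, dist_eq_norm] at h1
    exact absurd (h1.trans_le (ENNReal.ofReal_le_ofReal h2)) hm.not_gt
  · exact hf n (Subtype.val ⁻¹' U) ((hb.isOpen hU).preimage continuous_subtype_val) hn

theorem isCoanalyticSubset_hasSeparableAdjointRange [TopologicalSpace.SeparableSpace X]
    [CompleteSpace Y] [SecondCountableTopology Y] :
    IsCoanalyticSubset (sotBorel 𝕜 X Y) {T : X →L[𝕜] Y | HasSeparableAdjointRange T} := by
  have := sotBall.polishSpace (𝕜 := 𝕜) (X := Y) (Y := 𝕜) 1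
  have hb := TopologicalSpace.isBasis_countableBasis (sotBall 𝕜 Y 𝕜 1)
  refine isAnalyticSubset_of_forall_sotBall (Q := ℕ → sotBall 𝕜 Y 𝕜 1)
    (fun N => {p | ∃ m : ℕ, IsSeparatedDenseInItself (fun x => p.1.1 x) p.2 (1 / ((m : ℝ) + 1))
      (TopologicalSpace.countableBasis _)})
    (fun N => ?_) (fun N T => ⟨fun hT => exists_isSeparatedDenseInItself T.1 hT hb, ?_⟩)
  · let : MeasurableSpace (sotBall 𝕜 X Y N × (ℕ → sotBall 𝕜 Y 𝕜 1)) := borel _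
    have : BorelSpace (sotBall 𝕜 X Y N × (ℕ → sotBall 𝕜 Y 𝕜 1)) := ⟨rfl⟩
    have hf (n : ℕ) : Continuous
        fun p : sotBall 𝕜 X Y N × (ℕ → sotBall 𝕜 Y 𝕜 1) => p.2 n :=
      (continuous_apply n).comp continuous_snd
    have hfT (n : ℕ) (x : X) : Continuous
        fun p : sotBall 𝕜 X Y N × (ℕ → sotBall 𝕜 Y 𝕜 1) => (p.2 n).1 (p.1.1 x) :=
      (sotBall.continuous_eval 1).comp
        ((hf n).prodMk ((sotBall.continuous_apply _ x).comp continuous_fst))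
    have hU (n : ℕ) {U : Set (sotBall 𝕜 Y 𝕜 1)} (hU : U ∈ TopologicalSpace.countableBasis _) :
        MeasurableSet {p : sotBall 𝕜 X Y N × (ℕ → sotBall 𝕜 Y 𝕜 1) | p.2 n ∈ U} :=
      ((TopologicalSpace.isOpen_of_mem_countableBasis hU).preimage (hf n)).measurableSet
    simp only [IsSeparatedDenseInItself, ofPred_exists, ofPred_and, ofPred_forall]
    refine MeasurableSet.iUnion fun m => MeasurableSet.inter ?_ ?_
    · refine MeasurableSet.iInter fun n => MeasurableSet.iInter fun k =>
        MeasurableSet.iInter fun _ => IsOpen.measurableSet ?_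
      exact isOpen_iUnion fun x => isOpen_lt continuous_const ((hfT n x).sub (hfT k x)).norm
    · refine MeasurableSet.iInter fun n => MeasurableSet.biInter
        (TopologicalSpace.countable_countableBasis _) fun U hUb => ?_
      have himp : {p : sotBall 𝕜 X Y N × (ℕ → sotBall 𝕜 Y 𝕜 1) |
          p.2 n ∈ U → ∃ m ≠ n, p.2 m ∈ U} = {p | p.2 n ∈ U}ᶜ ∪ ⋃ m, ⋃ _ : m ≠ n, {p | p.2 m ∈ U} := by
        ext p
        simp [imp_iff_not_or]
      rw [himp]
      exact (hU n hUb).compl.union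
        (MeasurableSet.iUnion fun m => MeasurableSet.iUnion fun _ => hU m hUb)
  · rintro ⟨f, m, hfm⟩
    exact not_hasSeparableAdjointRange T.1 (by positivity) hb hfm

end Asplund

end OperatorSets

theorem mainTheorem4 {𝕜 : Type*} [RCLike 𝕜] (X Y : OperatorSets.SB 𝕜) :
    OperatorSets.IsCoanalyticSubset (OperatorSets.sotBorel 𝕜 X.toSubmodule Y.toSubmodule)
        {T : X.toSubmodule →L[𝕜] Y.toSubmodule | OperatorSets.IsWeaklyCompactOp T} ∧
      OperatorSets.IsCoanalyticSubset (OperatorSets.sotBorel 𝕜 X.toSubmodule Y.toSubmodule)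
        {T : X.toSubmodule →L[𝕜] Y.toSubmodule | OperatorSets.HasSeparableAdjointRange T} := by
  have : CompleteSpace Y.toSubmodule := Y.isClosed.completeSpace_coe
  exact ⟨OperatorSets.isCoanalyticSubset_isWeaklyCompactOp,
    OperatorSets.isCoanalyticSubset_hasSeparableAdjointRange⟩
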